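/- Let $\mathfrak g$ be a finite-dimensional complex semisimple Lie algebra with a nondegenerate invariant symmetric bilinear form $(\cdot,\cdot)$, and let $h\in\mathbb C$ be the dual Coxeter number of $\mathfrak g$ relative to this form, i.e. the Killing form of $\mathfrak g$ equals $2h(\cdot,\cdot)$; equivalently, the Casimir operator of $(\cdot,\cdot)$ acts on $\mathfrak g$ as the scalar $2h$. (If $\mathfrak g$ is simple and the form is normalized so that long roots have square length $2$, this is the usual dual Coxeter number.) Let $\hat{\mathfrak g}=\mathfrak g\otimes\mathbb C[t,t^{-1}]\oplus\mathbb C\mathbf k$ be the untwisted affine Lie algebra, where $\mathbf k$ is central and $$[a\otimes t^m,b\otimes t^n]=[a,b]\otimes t^{m+n}+m(a,b)\delta_{m+n,0}\mathbf k .$$ Put $\hat{\mathfrak g}_{(-)}=\mathfrak g\otimes t\mathbb C[t]$ and $\hat{\mathfrak g}_{(\le 0)}=\mathfrak g\otimes\mathbb C[t]\oplus\mathbb C\mathbf k$. Let $\kappa\in\mathbb C\setminus\mathbb Q_{\ge 0}$ and $\ell=\kappa-h$. A generalized Weyl module of level $\ell$ is an induced module $U(\hat{\mathfrak g})\otimes_{U(\hat{\mathfrak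 g}_{(\le 0)})}M$, where $M$ is a finite-dimensional $\hat{\mathfrak g}_{(\le 0)}$-module on which $\mathbf k$ acts as $\ell$, which is restricted (for all $a\in\mathfrak g$, $w\in M$, $(a\otimes t^n)w=0$ for $n$ sufficiently large) and on which $\hat{\mathfrak g}_{(-)}$ acts nilpotently. The objects of the category $\mathcal O_\kappa$ are the $\hat{\mathfrak g}$-modules that are quotients of a generalized Weyl module of level $\ell$. Such a module $W$ is restricted, and, as a generalized module for the vertex operator algebra $V_{\hat{\mathfrak g}}(\ell,0)$, its operator $L(0)$ is the Segal-Sugawara operator $$L(0)w=\frac1{2\kappa}\Big(\sum_{j\ge 0}\sum_p(c_p\otimes t^{-j})(c_p\otimes t^{j})w+\sum_{j<0}\sum_p(c_p\otimes t^{j})(c_p\otimes t^{-j})w\Big),$$ where $\{c_p\}$ is an orthonormal basis of $\mathfrak g$; for each $w$ only finitely many summands are nonzero. For $n\in\mathbb C$ let $W_{[n]}$ be the generalized eigenspace of $L(0)$ for the eigenvalue $n$. Then every object $W$ of $\mathcal O_\kappa$ is quasi-finite dimensional as a generalized $V_{\hat{\mathfrak g}}(\ell,0)$-module: $W=\coprod_{n\in\mathbb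 C}W_{[n]}$, and for every real number $N$ the space $\coprod_{\Re(n)<N}W_{[n]}$ is finite-dimensional. -/

import Mathlib

open scoped TensorProduct

noncomputable section

/-! ### The untwisted affine Lie algebra -/

section Affine

variable {𝔤 : Type*} [LieRing 𝔤] [LieAlgebra ℂ 𝔤]
  (B : LinearMap.BilinForm ℂ 𝔤) (hinv : B.lieInvariant 𝔤) (hsymm : B.IsSymm)

/-- The untwisted affine Lie algebra `𝔤 ⊗ ℂ[t, t⁻¹] ⊕ ℂ 𝐤` of `𝔤` with respect to an invariant
symmetric form `B`: the central extension of the loop algebra by Mathlib's residue cocycle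
`(a ⊗ tᵐ, b ⊗ tⁿ) ↦ -m B(a, b) δ_{m+n,0}`. -/
def AffineLieAlgebra : Type _ :=
  LieAlgebra.ofTwoCocycle (LieAlgebra.LoopAlgebra.twoCocycleOfBilinear ℂ ℤ 𝔤 B hinv hsymm)

namespace AffineLieAlgebra

instance : LieRing (AffineLieAlgebra B hinv hsymm) :=
  inferInstanceAs (LieRing (LieAlgebra.ofTwoCocycle _))

instance : LieAlgebra ℂ (AffineLieAlgebra B hinv hsymm) :=
  inferInstanceAs (LieAlgebra ℂ (LieAlgebra.ofTwoCocycle _))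

/-- The vector space `𝔤 ⊗ ℂ[t, t⁻¹] ⊕ ℂ 𝐤`, where `(0, 1)` is `𝐤`; the sign is chosen such that
`[a ⊗ tᵐ, b ⊗ tⁿ] = [a, b] ⊗ tᵐ⁺ⁿ + m B(a, b) δ_{m+n,0} 𝐤`. -/
def ofProd : (LieAlgebra.loopAlgebra ℂ ℤ 𝔤 × ℂ) ≃ₗ[ℂ] AffineLieAlgebra B hinv hsymm where
  toFun x := LieAlgebra.ofProd _ (x.1, -(TrivialLieModule.equiv ℂ _ ℂ).symm x.2)
  invFun y := (((LieAlgebra.ofProd _).symm y).1,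
    -(TrivialLieModule.equiv ℂ _ ℂ) ((LieAlgebra.ofProd _).symm y).2)
  map_add' x y := by
    refine Eq.trans ?_ (LieAlgebra.of_add _ _ _)
    simp only [Prod.mk_add_mk, Prod.fst_add, Prod.snd_add, map_add, neg_add]
    rfl
  map_smul' r x := by
    refine Eq.trans ?_ (LieAlgebra.of_smul _ _ _)
    simp only [Prod.smul_mk, Prod.smul_fst, Prod.smul_snd, map_smul, smul_neg, RingHom.id_apply]
    rfl
  left_inv x := by simp
  right_inv y := by
    obtain ⟨l, s⟩ := y
    simp only [map_neg, neg_neg, LinearEquiv.symm_apply_apply]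
    rfl

lemma ofProd_lie_ofProd (x y : LieAlgebra.loopAlgebra ℂ ℤ 𝔤 × ℂ) :
    ⁅ofProd B hinv hsymm x, ofProd B hinv hsymm y⁆ =
      ofProd B hinv hsymm
        (⁅x.1, y.1⁆, -LieAlgebra.LoopAlgebra.residuePairing ℂ ℤ 𝔤 B x.1 y.1) := by
  refine (LieAlgebra.bracket_ofTwoCocycle _ _).trans ?_
  refine congrArg (LieAlgebra.ofProd _) (Prod.ext rfl ?_)
  simp only [trivial_lie_zero, add_zero, sub_zero, map_neg, neg_neg]
  rfl

/-- The element `a ⊗ tⁿ`, linearly in `a`. -/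
def tpow (n : ℤ) : 𝔤 →ₗ[ℂ] AffineLieAlgebra B hinv hsymm where
  toFun a := ofProd B hinv hsymm (AddMonoidAlgebra.single n (1 : ℂ) ⊗ₜ[ℂ] a, 0)
  map_add' a b := by
    rw [← map_add, Prod.mk_add_mk, TensorProduct.tmul_add, add_zero]
  map_smul' r a := by
    rw [RingHom.id_apply, ← map_smul, Prod.smul_mk, TensorProduct.tmul_smul, smul_zero]

/-- The central element `𝐤`. -/
def central : AffineLieAlgebra B hinv hsymm := ofProd B hinv hsymm (0, 1)

lemma tpow_lie_tpow (m n : ℤ) (a b : 𝔤) :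
    ⁅tpow B hinv hsymm m a, tpow B hinv hsymm n b⁆ =
      tpow B hinv hsymm (m + n) ⁅a, b⁆ +
        (if m + n = 0 then (m : ℂ) * B a b else 0) • central B hinv hsymm := by
  have key : LieAlgebra.LoopAlgebra.residuePairing ℂ ℤ 𝔤 B
      (AddMonoidAlgebra.single m (1 : ℂ) ⊗ₜ[ℂ] a) (AddMonoidAlgebra.single n (1 : ℂ) ⊗ₜ[ℂ] b) =
      -(if m + n = 0 then (m : ℂ) * B a b else 0) := by
    rw [LieAlgebra.LoopAlgebra.residuePairing_apply_apply,
      LieAlgebra.LoopAlgebra.toFinsupp_single_tmul, LieAlgebra.LoopAlgebra.toFinsupp_single_tmul,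
      Finsupp.sum_single_index (by simp)]
    by_cases h : m + n = 0
    · obtain rfl : n = -m := by omega
      simp
    · rw [if_neg h, Finsupp.single_eq_of_ne (by omega)]
      simp
  simp only [tpow, central, LinearMap.coe_mk, AddHom.coe_mk]
  rw [ofProd_lie_ofProd, ← map_smul, ← map_add, key, neg_neg,
    LieAlgebra.ExtendScalars.bracket_tmul, AddMonoidAlgebra.single_mul_single, mul_one,
    Prod.smul_mk, Prod.mk_add_mk, smul_zero, add_zero, zero_add, smul_eq_mul, mul_one]

lemma central_lie (x : AffineLieAlgebra B hinv hsymm) : ⁅central B hinv hsymm, x⁆ = 0 := by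
  obtain ⟨x, rfl⟩ := (ofProd B hinv hsymm).surjective x
  rw [central, ofProd_lie_ofProd]
  refine (congrArg _ (Prod.ext (zero_lie x.1) ?_)).trans (map_zero _)
  change -LieAlgebra.LoopAlgebra.residuePairing ℂ ℤ 𝔤 B 0 x.1 = 0
  rw [map_zero, LinearMap.zero_apply, neg_zero]

lemma lie_central (x : AffineLieAlgebra B hinv hsymm) : ⁅x, central B hinv hsymm⁆ = 0 := by
  rw [← lie_skew, central_lie, neg_zero]

lemma span_eq_top : Submodule.span ℂ
    ({x | ∃ (n : ℤ) (a : 𝔤), x = tpow B hinv hsymm n a} ∪ {central B hinv hsymm}) = ⊤ := by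
  rw [eq_top_iff]
  rintro x -
  obtain ⟨⟨l, s⟩, rfl⟩ := (ofProd B hinv hsymm).surjective x
  set S := Submodule.span ℂ
    ({x | ∃ (n : ℤ) (a : 𝔤), x = tpow B hinv hsymm n a} ∪ {central B hinv hsymm})
  have h1 : ofProd B hinv hsymm (l, 0) ∈ S := by
    obtain ⟨f, rfl⟩ := (LieAlgebra.LoopAlgebra.toFinsupp ℂ ℤ 𝔤).symm.surjective l
    induction f using Finsupp.induction_linear with
    | zero => rw [map_zero, Prod.mk_zero_zero, map_zero]; exact zero_mem _
    | add f g hf hg =>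
      have := add_mem hf hg
      rwa [← map_add, Prod.mk_add_mk, add_zero, ← map_add] at this
    | single n a =>
      rw [LieAlgebra.LoopAlgebra.toFinsupp_symm_single]
      exact Submodule.subset_span (Or.inl ⟨n, a, rfl⟩)
  have h2 : ofProd B hinv hsymm (0, s) ∈ S := by
    have := S.smul_mem s (Submodule.subset_span (Or.inr rfl))
    rwa [central, ← map_smul, Prod.smul_mk, smul_zero, smul_eq_mul, mul_one] at this
  have := add_mem h1 h2
  rwa [← map_add, Prod.mk_add_mk, add_zero, zero_add] at this

/-- The subalgebra `𝔤 ⊗ ℂ[t] ⊕ ℂ 𝐤`. -/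
def nonpos : LieSubalgebra ℂ (AffineLieAlgebra B hinv hsymm) where
  toSubmodule := Submodule.span ℂ
    ({x | ∃ (n : ℤ) (a : 𝔤), 0 ≤ n ∧ x = tpow B hinv hsymm n a} ∪ {central B hinv hsymm})
  lie_mem' {x y} hx hy := by
    simp only [AddSubsemigroup.mem_carrier, AddSubmonoid.mem_toSubsemigroup,
      Submodule.mem_toAddSubmonoid] at hx hy ⊢
    induction hx, hy using Submodule.span_induction₂ with
    | mem_mem x y hx hy =>
      rcases hx with ⟨m, a, hm, rfl⟩ | rfl
      · rcases hy with ⟨n, b, hn, rfl⟩ | rfl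
        · rw [tpow_lie_tpow]
          exact add_mem (Submodule.subset_span (Or.inl ⟨m + n, _, by omega, rfl⟩))
            (Submodule.smul_mem _ _ (Submodule.subset_span (Or.inr rfl)))
        · rw [lie_central]; exact zero_mem _
      · rw [central_lie]; exact zero_mem _
    | zero_left y hy => rw [zero_lie]; exact zero_mem _
    | zero_right x hx => rw [lie_zero]; exact zero_mem _
    | add_left x y z _ _ _ h1 h2 => rw [add_lie]; exact add_mem h1 h2
    | add_right x y z _ _ _ h1 h2 => rw [lie_add]; exact add_mem h1 h2
    | smul_left r x y _ _ h => rw [smul_lie]; exact Submodule.smul_mem _ _ h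
    | smul_right r x y _ _ h => rw [lie_smul]; exact Submodule.smul_mem _ _ h

/-- The subalgebra `𝔤 ⊗ t ℂ[t]`. -/
def minus : LieSubalgebra ℂ (AffineLieAlgebra B hinv hsymm) where
  toSubmodule := Submodule.span ℂ
    {x | ∃ (n : ℤ) (a : 𝔤), 0 < n ∧ x = tpow B hinv hsymm n a}
  lie_mem' {x y} hx hy := by
    simp only [AddSubsemigroup.mem_carrier, AddSubmonoid.mem_toSubsemigroup,
      Submodule.mem_toAddSubmonoid] at hx hy ⊢
    induction hx, hy using Submodule.span_induction₂ with
    | mem_mem x y hx hy =>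
      obtain ⟨m, a, hm, rfl⟩ := hx
      obtain ⟨n, b, hn, rfl⟩ := hy
      rw [tpow_lie_tpow, if_neg (by omega), zero_smul, add_zero]
      exact Submodule.subset_span ⟨m + n, _, by omega, rfl⟩
    | zero_left y hy => rw [zero_lie]; exact zero_mem _
    | zero_right x hx => rw [lie_zero]; exact zero_mem _
    | add_left x y z _ _ _ h1 h2 => rw [add_lie]; exact add_mem h1 h2
    | add_right x y z _ _ _ h1 h2 => rw [lie_add]; exact add_mem h1 h2
    | smul_left r x y _ _ h => rw [smul_lie]; exact Submodule.smul_mem _ _ h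
    | smul_right r x y _ _ h => rw [lie_smul]; exact Submodule.smul_mem _ _ h

lemma tpow_mem_nonpos {n : ℤ} (hn : 0 ≤ n) (a : 𝔤) :
    tpow B hinv hsymm n a ∈ nonpos B hinv hsymm :=
  Submodule.subset_span (Or.inl ⟨n, a, hn, rfl⟩)

lemma central_mem_nonpos : central B hinv hsymm ∈ nonpos B hinv hsymm :=
  Submodule.subset_span (Or.inr rfl)

end AffineLieAlgebra

end Affine

/-! ### Induced modules -/

section Induced

variable {R L : Type*} [CommRing R] [LieRing L] [LieAlgebra R L] (K : LieSubalgebra R L)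
  (M : Type*) [AddCommGroup M] [Module R M] [LieRingModule K M]

/-- The relations `u x ⊗ m = u ⊗ x m`, for `u ∈ U(L)`, `x ∈ K`, `m ∈ M`. -/
def inducedRelations :
    Submodule (UniversalEnvelopingAlgebra R L) (UniversalEnvelopingAlgebra R L ⊗[R] M) :=
  Submodule.span _ {z | ∃ (u : UniversalEnvelopingAlgebra R L) (x : K) (m : M),
    z = (u * UniversalEnvelopingAlgebra.ι R (x : L)) ⊗ₜ[R] m - u ⊗ₜ[R] ⁅x, m⁆}

/-- The induced module `U(L) ⊗_{U(K)} M`. -/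
abbrev InducedModule : Type _ :=
  (UniversalEnvelopingAlgebra R L ⊗[R] M) ⧸ inducedRelations K M

namespace InducedModule

/-- The action of `L` by left multiplication. -/
instance : LieRingModule L (InducedModule K M) where
  bracket x w := UniversalEnvelopingAlgebra.ι R x • w
  add_lie x y w := by rw [map_add, add_smul]
  lie_add x w w' := smul_add _ _ _
  leibniz_lie x y w := by
    let _ := LieRing.ofAssociativeRing (A := UniversalEnvelopingAlgebra R L)
    rw [LieHom.map_lie, LieRing.of_associative_ring_bracket, sub_smul, mul_smul, mul_smul,
      sub_add_cancel]

lemma lie_def (x : L) (w : InducedModule K M) :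
    ⁅x, w⁆ = UniversalEnvelopingAlgebra.ι R x • w := rfl

/-- The canonical map `m ↦ 1 ⊗ m`. -/
def of (m : M) : InducedModule K M :=
  (inducedRelations K M).mkQ (1 ⊗ₜ[R] m)

lemma lie_of (x : K) (m : M) : ⁅(x : L), of (R := R) K M m⁆ = of K M ⁅x, m⁆ := by
  rw [lie_def, of, of, ← LinearMap.map_smul, ← sub_eq_zero, ← map_sub, Submodule.mkQ_apply,
    Submodule.Quotient.mk_eq_zero]
  refine Submodule.subset_span ⟨1, x, m, ?_⟩
  rw [TensorProduct.smul_tmul', smul_eq_mul, mul_one, one_mul]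


instance : LieModule R L (InducedModule K M) where
  smul_lie r x w := by rw [lie_def, lie_def, map_smul, smul_assoc]
  lie_smul r x w := by rw [lie_def, lie_def, smul_comm]

lemma adjoin_range_ι :
    Algebra.adjoin R (Set.range (UniversalEnvelopingAlgebra.ι R (L := L))) = ⊤ := by
  have h1 : Function.Surjective (UniversalEnvelopingAlgebra.mkAlgHom R L) :=
    RingCon.mk'_surjective _
  rw [← AlgHom.range_eq_top] at h1
  rw [← h1, ← Algebra.map_top, ← TensorAlgebra.adjoin_range_ι, AlgHom.map_adjoin, ← Set.range_comp]
  rfl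

end InducedModule

end Induced

/-! ### Generalized Weyl modules and the category `𝒪_κ` -/

section CategoryO

variable {𝔤 : Type*} [LieRing 𝔤] [LieAlgebra ℂ 𝔤]
  (B : LinearMap.BilinForm ℂ 𝔤) (hinv : B.lieInvariant 𝔤) (hsymm : B.IsSymm)

open AffineLieAlgebra

/-- `h` is the dual Coxeter number of `𝔤` relative to the form `B`: the Killing form is `2h B`
(equivalently, the Casimir operator of `B` acts on `𝔤` as `2h`). -/
def IsDualCoxeterNumber (h : ℂ) : Prop :=
  killingForm ℂ 𝔤 = (2 * h) • B

/-- The conditions on a `𝔤 ⊗ ℂ[t] ⊕ ℂ 𝐤`-module `M` under which the module induced from it is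
a generalized Weyl module of level `ℓ`. -/
structure IsWeylDatum (ℓ : ℂ) (M : Type*) [AddCommGroup M] [Module ℂ M]
    [LieRingModule (nonpos B hinv hsymm) M] [LieModule ℂ (nonpos B hinv hsymm) M] : Prop where
  finiteDimensional : FiniteDimensional ℂ M
  level : ∀ m : M, ⁅(⟨central B hinv hsymm, central_mem_nonpos B hinv hsymm⟩ :
    nonpos B hinv hsymm), m⁆ = ℓ • m
  restricted : ∀ (a : 𝔤) (m : M), ∃ N : ℕ, ∀ (n : ℤ) (hn : 0 ≤ n), (N : ℤ) ≤ n →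
    ⁅(⟨tpow B hinv hsymm n a, tpow_mem_nonpos B hinv hsymm hn a⟩ :
      nonpos B hinv hsymm), m⁆ = 0
  nilpotent : LieModule.IsNilpotent
    ((minus B hinv hsymm).comap (nonpos B hinv hsymm).incl) M

variable (W : Type*) [AddCommGroup W] [Module ℂ W]
  [LieRingModule (AffineLieAlgebra B hinv hsymm) W] [LieModule ℂ (AffineLieAlgebra B hinv hsymm) W]

/-- `W` is restricted: `(a ⊗ tⁿ) w = 0` for `n` sufficiently large. -/
def IsRestricted : Prop :=
  ∀ (a : 𝔤) (w : W), ∃ N : ℤ, ∀ n : ℤ, N ≤ n → ⁅tpow B hinv hsymm n a, w⁆ = 0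

/-- `W` is an object of `𝒪_κ`: a quotient of a generalized Weyl module of level `κ - h`.
As `M` is finite-dimensional, it is no restriction to take it in `Type`. -/
def IsObjectO (h κ : ℂ) : Prop :=
  ∃ (M : Type) (_ : AddCommGroup M) (_ : Module ℂ M)
    (_ : LieRingModule (nonpos B hinv hsymm) M) (_ : LieModule ℂ (nonpos B hinv hsymm) M),
    IsWeylDatum B hinv hsymm (κ - h) M ∧
    ∃ π : InducedModule (nonpos B hinv hsymm) M →ₗ⁅ℂ, AffineLieAlgebra B hinv hsymm⁆ W,
      Function.Surjective π

variable {B hinv hsymm W}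

variable (B hinv hsymm W) in
/-- The subspace of the vectors `w` such that `(a ⊗ tⁿ) w = 0` for `n` sufficiently large. -/
def restrictedVectors : Submodule ℂ W where
  carrier := {w | ∀ a : 𝔤, ∃ N : ℤ, ∀ n : ℤ, N ≤ n → ⁅tpow B hinv hsymm n a, w⁆ = 0}
  zero_mem' a := ⟨0, fun n _ => lie_zero _⟩
  add_mem' {v w} hv hw a := by
    obtain ⟨N, hN⟩ := hv a
    obtain ⟨N', hN'⟩ := hw a
    refine ⟨max N N', fun n hn => ?_⟩
    rw [lie_add, hN n (by omega), hN' n (by omega), add_zero]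
  smul_mem' r w hw a := by
    obtain ⟨N, hN⟩ := hw a
    exact ⟨N, fun n hn => by rw [lie_smul, hN n hn, smul_zero]⟩

lemma lie_mem_restrictedVectors (x : AffineLieAlgebra B hinv hsymm) {w : W}
    (hw : w ∈ restrictedVectors B hinv hsymm W) : ⁅x, w⁆ ∈ restrictedVectors B hinv hsymm W := by
  have hx := span_eq_top B hinv hsymm ▸ Submodule.mem_top (R := ℂ) (x := x)
  induction hx using Submodule.span_induction with
  | mem x hx =>
    rcases hx with ⟨m, b, rfl⟩ | rfl
    · intro a
      obtain ⟨N, hN⟩ := hw a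
      obtain ⟨N', hN'⟩ := hw ⁅a, b⁆
      refine ⟨max (max N (N' - m)) (1 - m), fun n hn => ?_⟩
      rw [leibniz_lie, tpow_lie_tpow, if_neg (by omega), zero_smul, add_zero, hN n (by omega),
        hN' (n + m) (by omega), lie_zero, add_zero]
    · intro a
      obtain ⟨N, hN⟩ := hw a
      refine ⟨N, fun n hn => ?_⟩
      rw [leibniz_lie, lie_central, zero_lie, hN n hn, lie_zero, add_zero]
  | zero => rw [zero_lie]; exact zero_mem _
  | add x y _ _ h1 h2 => rw [add_lie]; exact add_mem h1 h2
  | smul r x _ h => rw [smul_lie]; exact Submodule.smul_mem _ _ h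

/-- Every object of `𝒪_κ` is restricted. -/
theorem IsObjectO.isRestricted {h κ : ℂ} (hW : IsObjectO B hinv hsymm W h κ) :
    IsRestricted B hinv hsymm W := by
  obtain ⟨M, _, _, _, _, hM, π, hπ⟩ := hW
  suffices H : ∀ (u : UniversalEnvelopingAlgebra ℂ (AffineLieAlgebra B hinv hsymm))
      (v : InducedModule (nonpos B hinv hsymm) M),
      π v ∈ restrictedVectors B hinv hsymm W → π (u • v) ∈ restrictedVectors B hinv hsymm W by
    intro a w
    obtain ⟨v, rfl⟩ := hπ w
    refine (?_ : π v ∈ restrictedVectors B hinv hsymm W) a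
    obtain ⟨z, rfl⟩ := Submodule.mkQ_surjective _ v
    induction z using TensorProduct.induction_on with
    | zero => rw [map_zero, map_zero]; exact zero_mem _
    | add x y hx hy => rw [map_add, map_add]; exact add_mem hx hy
    | tmul u m =>
      have hu : u ⊗ₜ[ℂ] m = u • ((1 : UniversalEnvelopingAlgebra ℂ
          (AffineLieAlgebra B hinv hsymm)) ⊗ₜ[ℂ] m) := by
        rw [TensorProduct.smul_tmul', smul_eq_mul, mul_one]
      rw [hu, map_smul]
      refine H u _ fun a => ?_
      obtain ⟨N, hN⟩ := hM.restricted a m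
      refine ⟨N, fun n hn => ?_⟩
      have h0 : (0 : ℤ) ≤ n := by omega
      have := InducedModule.lie_of (R := ℂ) (nonpos B hinv hsymm) M
        ⟨tpow B hinv hsymm n a, tpow_mem_nonpos B hinv hsymm h0 a⟩ m
      rw [hN n h0 hn] at this
      rw [← LieModuleHom.map_lie]
      refine (congrArg π this).trans ?_
      simp [InducedModule.of]
  intro u
  have hu : u ∈ Algebra.adjoin ℂ (Set.range (UniversalEnvelopingAlgebra.ι ℂ
      (L := AffineLieAlgebra B hinv hsymm))) :=
    InducedModule.adjoin_range_ι (R := ℂ) (L := AffineLieAlgebra B hinv hsymm) ▸ Algebra.mem_top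
  induction hu using Algebra.adjoin_induction with
  | mem u hu =>
    obtain ⟨x, rfl⟩ := hu
    intro v hv
    rw [← InducedModule.lie_def, LieModuleHom.map_lie]
    exact lie_mem_restrictedVectors x hv
  | algebraMap r =>
    intro v hv
    rw [algebraMap_smul, map_smul]
    exact Submodule.smul_mem _ _ hv
  | add u u' _ _ h1 h2 =>
    intro v hv
    rw [add_smul, map_add]
    exact add_mem (h1 v hv) (h2 v hv)
  | mul u u' _ _ h1 h2 =>
    intro v hv
    rw [mul_smul]
    exact h1 _ (h2 v hv)

/-! ### The Segal-Sugawara operators -/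

set_option linter.unusedSectionVars false

/-- The summand with index `j` in the Segal-Sugawara operator `L_k`. -/
def segalSugawaraTerm (B : LinearMap.BilinForm ℂ 𝔤) (hinv : B.lieInvariant 𝔤) (hsymm : B.IsSymm)
    {ι : Type*} [Fintype ι] (c : Module.Basis ι ℂ 𝔤) (k j : ℤ) (w : W)
    [LieRingModule (AffineLieAlgebra B hinv hsymm) W] : W :=
  if -k ≤ 2 * j then
    ∑ p, ⁅tpow B hinv hsymm (-j) (c p), ⁅tpow B hinv hsymm (j + k) (c p), w⁆⁆
  else
    ∑ p, ⁅tpow B hinv hsymm (j + k) (c p), ⁅tpow B hinv hsymm (-j) (c p), w⁆⁆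

lemma segalSugawaraTerm_add {ι : Type*} [Fintype ι] (c : Module.Basis ι ℂ 𝔤) (k j : ℤ) (v w : W) :
    segalSugawaraTerm B hinv hsymm c k j (v + w) =
      segalSugawaraTerm B hinv hsymm c k j v + segalSugawaraTerm B hinv hsymm c k j w := by
  simp only [segalSugawaraTerm, lie_add, Finset.sum_add_distrib]
  split <;> rfl

lemma segalSugawaraTerm_smul {ι : Type*} [Fintype ι] (c : Module.Basis ι ℂ 𝔤) (k j : ℤ) (r : ℂ)
    (w : W) : segalSugawaraTerm B hinv hsymm c k j (r • w) =
      r • segalSugawaraTerm B hinv hsymm c k j w := by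
  simp only [segalSugawaraTerm, lie_smul, ← Finset.smul_sum]
  split <;> rfl

lemma IsRestricted.finite_support (hW : IsRestricted B hinv hsymm W) {ι : Type*} [Fintype ι]
    (c : Module.Basis ι ℂ 𝔤) (k : ℤ) (w : W) :
    (Function.support fun j => segalSugawaraTerm B hinv hsymm c k j w).Finite := by
  choose N hN using fun p => hW (c p) w
  obtain ⟨N', hN'⟩ := (Set.finite_range N).bddAbove
  have hle : ∀ p, N p ≤ N' := fun p => hN' ⟨p, rfl⟩
  refine (Set.finite_Icc (-N') (N' - k)).subset fun j hj => ?_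
  by_contra hj'
  rw [Set.mem_Icc, not_and_or, not_le, not_le] at hj'
  refine hj ?_
  simp only [segalSugawaraTerm]
  split_ifs with hc
  · refine Finset.sum_eq_zero fun p _ => ?_
    have := hle p
    rw [hN p (j + k) (by omega), lie_zero]
  · refine Finset.sum_eq_zero fun p _ => ?_
    have := hle p
    rw [hN p (-j) (by omega), lie_zero]

/-- The Segal-Sugawara operator
`L_k = (1 / 2κ) (∑_{j ≥ -k/2} ∑_p (c_p ⊗ t⁻ʲ)(c_p ⊗ tʲ⁺ᵏ) + ∑_{j < -k/2} ∑_p (c_p ⊗ tʲ⁺ᵏ)(c_p ⊗ t⁻ʲ))`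
on a restricted module; on each vector only finitely many summands are nonzero. -/
def segalSugawara (hW : IsRestricted B hinv hsymm W) (κ : ℂ) {ι : Type*} [Fintype ι]
    (c : Module.Basis ι ℂ 𝔤) (k : ℤ) : Module.End ℂ W where
  toFun w := (1 / (2 * κ)) • ∑ᶠ j : ℤ, segalSugawaraTerm B hinv hsymm c k j w
  map_add' v w := by
    simp only [segalSugawaraTerm_add]
    rw [finsum_add_distrib (hW.finite_support c k v) (hW.finite_support c k w), smul_add]
  map_smul' r w := by
    simp only [segalSugawaraTerm_smul]
    rw [← smul_finsum' r (hW.finite_support c k w), smul_comm, RingHom.id_apply]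

end CategoryO

/-- Quasi-finite dimensionality with respect to the operator `L₀`: for every real `N`, the sum of
the generalized eigenspaces of `L₀` for the eigenvalues of real part less than `N` is
finite-dimensional. -/
def IsQuasiFiniteDimensional {W : Type*} [AddCommGroup W] [Module ℂ W] (L₀ : Module.End ℂ W) :
    Prop :=
  ∀ N : ℝ, FiniteDimensional ℂ (⨆ n ∈ {n : ℂ | n.re < N}, L₀.maxGenEigenspace n : Submodule ℂ W)

end

noncomputable section

/-! ### Orthonormal bases for an invariant form -/

section Orthonormal

variable {𝔤 : Type*} [LieRing 𝔤] [LieAlgebra ℂ 𝔤] {B : LinearMap.BilinForm ℂ 𝔤}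
  {ι : Type*} [DecidableEq ι] {c : Module.Basis ι ℂ 𝔤}

/-! Let `T` be L(0) and `M` the image in W of the finite-dimensional inducing module. Everything
rests on `sugawara_commutation`: a ⊗ t⁻ᴺ shifts generalized eigenvalues of `T` by N. The Casimir
element contributes the h, and the central terms the ℓ, in 2κ = 2(ℓ + h).

Let V be the sum of the generalized eigenspaces of `T`; it is stable under the modes t⁻ᴺ with N ≥ 0.
The inclusion of `M` in V (`le_iSup_maxGenEigenspace_of_nilpotent`) follows from nilpotency of 𝔤 ⊗
tℂ[t]. On vectors of `M` whose positive modes already lie in V, `T` agrees modulo V with the Casimir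
operator of 𝔤 divided by 2κ. That operator preserves a finite-dimensional space, so a nonzero
polynomial in `T` sends this space into V. Over ℂ this forces the space itself into V.

Finally W is spanned by monomials in negative modes applied to `M`. Those of degree d form a
finite-dimensional space with eigenvalues in Λ + d, for one finite set Λ. Hence V = W, and only
finitely many degrees matter below a given real part (`isInternal_and_isQuasiFiniteDimensional`). -/

lemma form_comm_of_orthonormal (hc : ∀ p q : ι, B (c p) (c q) = if p = q then 1 else 0)
    (x y : 𝔤) : B x y = B y x := by
  refine LinearMap.congr_fun₂ (f := B) (g := B.flip) (c.ext fun p => c.ext fun q => ?_) x y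
  refine (hc p q).trans (Eq.trans ?_ (hc q p).symm)
  simp only [eq_comm]

variable [Fintype ι]

lemma repr_eq_of_orthonormal (hc : ∀ p q : ι, B (c p) (c q) = if p = q then 1 else 0)
    (x : 𝔤) (q : ι) : c.repr x q = B x (c q) := by
  conv_rhs => rw [← c.sum_repr x]
  simp only [map_sum, map_smul, LinearMap.sum_apply, LinearMap.smul_apply, hc, smul_eq_mul,
    mul_ite, mul_one, mul_zero, Finset.sum_ite_eq', Finset.mem_univ, if_true]

lemma sum_smul_of_orthonormal (hc : ∀ p q : ι, B (c p) (c q) = if p = q then 1 else 0) (x : 𝔤) :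
    ∑ q, B x (c q) • c q = x := by
  simp_rw [← repr_eq_of_orthonormal hc]
  exact c.sum_repr x

/-- The tensor `∑ c_p ⊗ c_p` is invariant. -/
lemma sum_lie_left_of_orthonormal (hc : ∀ p q : ι, B (c p) (c q) = if p = q then 1 else 0)
    (hinv : B.lieInvariant 𝔤) {V : Type*} [AddCommGroup V] [Module ℂ V]
    (β : 𝔤 →ₗ[ℂ] 𝔤 →ₗ[ℂ] V) (a : 𝔤) :
    ∑ p, β (c p) ⁅a, c p⁆ = -∑ p, β ⁅a, c p⁆ (c p) := by
  -- The matrix of ad a in an orthonormal basis is skew-symmetric.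
  have hB : ∀ p q, B ⁅a, c p⁆ (c q) = - B ⁅a, c q⁆ (c p) := by
    intro p q
    rw [hinv, form_comm_of_orthonormal hc]
  have h1 : ∀ p, β ⁅a, c p⁆ (c p) = ∑ q, B ⁅a, c p⁆ (c q) • β (c q) (c p) := by
    intro p
    conv_lhs => rw [← sum_smul_of_orthonormal hc ⁅a, c p⁆]
    simp
  have h2 : ∀ p, β (c p) ⁅a, c p⁆ = ∑ q, B ⁅a, c p⁆ (c q) • β (c p) (c q) := by
    intro p
    conv_lhs => rw [← sum_smul_of_orthonormal hc ⁅a, c p⁆]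
    simp
  simp_rw [h1, h2]
  rw [Finset.sum_comm, ← Finset.sum_neg_distrib]
  refine Finset.sum_congr rfl fun p _ => ?_
  rw [← Finset.sum_neg_distrib]
  refine Finset.sum_congr rfl fun q _ => ?_
  rw [hB, neg_smul]

/-- The Casimir operator of `B` acts on the adjoint representation as `2h`. -/
lemma sum_lie_lie_of_isDualCoxeterNumber
    (hc : ∀ p q : ι, B (c p) (c q) = if p = q then 1 else 0)
    (hinv : B.lieInvariant 𝔤) (hnondeg : B.Nondegenerate) {h : ℂ}
    (hh : IsDualCoxeterNumber B h) (a : 𝔤) :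
    ∑ p, ⁅c p, ⁅c p, a⁆⁆ = (2 * h) • a := by
  refine sub_eq_zero.1 (hnondeg.1 _ fun b => ?_)
  rw [map_sub, LinearMap.sub_apply, sub_eq_zero]
  have h1 : killingForm ℂ 𝔤 a b = 2 * h * B a b := by
    rw [show killingForm ℂ 𝔤 = (2 * h) • B from hh]
    simp
  rw [map_smul, LinearMap.smul_apply, smul_eq_mul, ← h1, killingForm_apply_apply,
    LinearMap.trace_eq_matrix_trace ℂ c]
  simp only [Matrix.trace, Matrix.diag, LinearMap.toMatrix_apply, repr_eq_of_orthonormal hc,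
    LinearMap.comp_apply, LieAlgebra.ad_apply, map_sum, LinearMap.sum_apply]
  refine Finset.sum_congr rfl fun p _ => ?_
  -- Invariance turns both summands into -B([c_p, a], [c_p, b]), so the trace matches the Casimir
  -- term by term.
  rw [hinv, hinv a, form_comm_of_orthonormal hc ⁅b, c p⁆, ← lie_skew a (c p), ← lie_skew b (c p)]
  simp only [map_neg, LinearMap.neg_apply, neg_neg]

end Orthonormal

/-! ### The Sugawara commutation relation -/

section Sugawara

variable {𝔤 : Type*} [LieRing 𝔤] [LieAlgebra ℂ 𝔤] {B : LinearMap.BilinForm ℂ 𝔤}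
  {W : Type*} [AddCommGroup W] [Module ℂ W]

/-- The operators `A n a` on `W` satisfy the relations of the operators `a ⊗ tⁿ` on a module of
level `ℓ`. -/
def IsAffineAction (B : LinearMap.BilinForm ℂ 𝔤) (ℓ : ℂ) (A : ℤ → 𝔤 →ₗ[ℂ] Module.End ℂ W) :
    Prop :=
  ∀ (m n : ℤ) (a b : 𝔤), A m a * A n b =
    A n b * A m a + A (m + n) ⁅a, b⁆ + (if m + n = 0 then (m : ℂ) * B a b * ℓ else 0) • 1

/-- The operator `∑ (c_p ⊗ t⁻ʲ)(c_p ⊗ tʲ)`. -/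
def casimirMode {ι : Type*} [Fintype ι] (A : ℤ → 𝔤 →ₗ[ℂ] Module.End ℂ W)
    (c : Module.Basis ι ℂ 𝔤) (j : ℤ) : Module.End ℂ W :=
  ∑ p, A (-j) (c p) * A j (c p)

/-- The operator `∑ ([a, c_p] ⊗ tᵐ)(c_p ⊗ tⁿ)`. -/
def adjointMode {ι : Type*} [Fintype ι] (A : ℤ → 𝔤 →ₗ[ℂ] Module.End ℂ W)
    (c : Module.Basis ι ℂ 𝔤) (a : 𝔤) (m n : ℤ) : Module.End ℂ W :=
  ∑ p, A m ⁅a, c p⁆ * A n (c p)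

variable {ι : Type*} [Fintype ι] [DecidableEq ι] {c : Module.Basis ι ℂ 𝔤}
  {A : ℤ → 𝔤 →ₗ[ℂ] Module.End ℂ W} {ℓ : ℂ}

lemma sum_mul_adjoint (hc : ∀ p q : ι, B (c p) (c q) = if p = q then 1 else 0)
    (hinv : B.lieInvariant 𝔤) (a : 𝔤) (m n : ℤ) :
    ∑ p, A m (c p) * A n ⁅a, c p⁆ = -adjointMode A c a m n :=
  sum_lie_left_of_orthonormal hc hinv
    ((LinearMap.mul ℂ (Module.End ℂ W)).compl₁₂ (A m) (A n)) a

lemma sum_form_smul (hc : ∀ p q : ι, B (c p) (c q) = if p = q then 1 else 0) (a : 𝔤) (n : ℤ) :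
    ∑ p, B a (c p) • A n (c p) = A n a := by
  conv_rhs => rw [← sum_smul_of_orthonormal hc a]
  simp

/-- `A n a` is moved past the two factors in turn. Each bracket gives an `adjointMode`, the second
with a minus sign by invariance of ∑ c_p ⊗ c_p. Each central term contracts against the basis to a
single mode of a. -/
lemma mul_casimirMode (hA : IsAffineAction B ℓ A)
    (hc : ∀ p q : ι, B (c p) (c q) = if p = q then 1 else 0) (hinv : B.lieInvariant 𝔤)
    (a : 𝔤) (n j : ℤ) :
    A n a * casimirMode A c j = casimirMode A c j * A n a + adjointMode A c a (n - j) j -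
      adjointMode A c a (-j) (n + j) + (if n - j = 0 then (n : ℂ) * ℓ else 0) • A j a +
      (if n + j = 0 then (n : ℂ) * ℓ else 0) • A (-j) a := by
  have key : ∀ p, A n a * (A (-j) (c p) * A j (c p)) =
      A (-j) (c p) * A j (c p) * A n a + A (n - j) ⁅a, c p⁆ * A j (c p) +
      A (-j) (c p) * A (n + j) ⁅a, c p⁆ +
      (if n - j = 0 then (n : ℂ) * ℓ else 0) • B a (c p) • A j (c p) +
      (if n + j = 0 then (n : ℂ) * ℓ else 0) • B a (c p) • A (-j) (c p) := by
    intro p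
    rw [← mul_assoc, hA n (-j), add_mul, add_mul, mul_assoc _ (A n a), hA n j, mul_add, mul_add,
      ← sub_eq_add_neg]
    have h1 : (if n - j = 0 then (n : ℂ) * B a (c p) * ℓ else 0) =
      (if n - j = 0 then (n : ℂ) * ℓ else 0) * B a (c p) := by split_ifs <;> ring
    have h2 : (if n + j = 0 then (n : ℂ) * B a (c p) * ℓ else 0) =
      (if n + j = 0 then (n : ℂ) * ℓ else 0) * B a (c p) := by split_ifs <;> ring
    rw [h1, h2, mul_smul_comm, smul_mul_assoc, one_mul, mul_one, mul_smul, mul_smul, mul_assoc]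
    abel
  rw [casimirMode, Finset.mul_sum, Finset.sum_congr rfl fun p _ => key p]
  simp only [Finset.sum_add_distrib, ← Finset.smul_sum]
  rw [sum_mul_adjoint hc hinv, sum_form_smul hc, sum_form_smul hc, ← Finset.sum_mul,
    ← sub_eq_add_neg]
  rfl

/-- By invariance the second term is -∑ (c_p ⊗ tⁿ)([a, c_p] ⊗ tᵐ), so the left side is a sum of
commutators. Their brackets assemble to the Casimir action on a, and their central parts vanish
since B([a, c_p], c_p) = 0. -/
lemma adjointMode_add_swap (hA : IsAffineAction B ℓ A)
    (hc : ∀ p q : ι, B (c p) (c q) = if p = q then 1 else 0) (hinv : B.lieInvariant 𝔤)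
    {h : ℂ} (hcas : ∀ a : 𝔤, ∑ p, ⁅c p, ⁅c p, a⁆⁆ = (2 * h) • a) (a : 𝔤) (m n : ℤ) :
    adjointMode A c a m n + adjointMode A c a n m = (2 * h) • A (m + n) a := by
  have hB : ∑ p, B ⁅a, c p⁆ (c p) = 0 := by
    refine Finset.sum_eq_zero fun p _ => ?_
    rw [← lie_skew, map_neg, LinearMap.neg_apply, hinv, lie_self, map_zero, neg_zero, neg_zero]
  rw [← sub_neg_eq_add, ← sum_mul_adjoint hc hinv, adjointMode, ← Finset.sum_sub_distrib]
  simp only [hA m n, add_assoc, add_sub_cancel_left]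
  rw [Finset.sum_add_distrib, ← Finset.sum_smul, ← map_smul, ← hcas, map_sum]
  have h0 : ∑ p, (if m + n = 0 then (m : ℂ) * B ⁅a, c p⁆ (c p) * ℓ else 0) = 0 := by
    split_ifs
    · rw [← Finset.sum_mul, ← Finset.mul_sum, hB, mul_zero, zero_mul]
    · exact Finset.sum_const_zero
  rw [h0, zero_smul, add_zero]
  refine Finset.sum_congr rfl fun p _ => ?_
  rw [← lie_skew (c p) ⁅c p, a⁆, ← lie_skew (c p) a, neg_lie, neg_neg]

/-- Telescoping with step N: only N boundary terms survive at each end. -/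
lemma sum_range_sub_shift {V : Type*} [AddCommGroup V] (g : ℤ → V) (J N : ℕ) :
    ∑ j ∈ Finset.range J, (g (j + 1) - g (j + 1 - N)) =
      ∑ i ∈ Finset.range N, (g (J - i) - g (-i)) := by
  induction N with
  | zero => simp
  | succ N ih =>
    rw [Finset.sum_range_succ, ← ih, ← sub_eq_iff_eq_add', ← Finset.sum_sub_distrib]
    have := Finset.sum_range_sub (fun j : ℕ => g (j - N)) J
    simp only [Nat.cast_zero, zero_sub] at this
    rw [← this]
    refine Finset.sum_congr rfl fun j _ => ?_
    push_cast
    rw [show (j : ℤ) + 1 - (N + 1) = j - N by ring]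
    abel

/-- Let `T` be the Segal-Sugawara operator `L(0)`. Then `[T, a ⊗ t⁻ᴺ] = N (a ⊗ t⁻ᴺ)`. -/
theorem sugawara_commutation (hA : IsAffineAction B ℓ A)
    (hc : ∀ p q : ι, B (c p) (c q) = if p = q then 1 else 0) (hinv : B.lieInvariant 𝔤)
    {h κ : ℂ} (hcas : ∀ a : 𝔤, ∑ p, ⁅c p, ⁅c p, a⁆⁆ = (2 * h) • a) (hℓ : κ = ℓ + h) (hκ : κ ≠ 0)
    (hres : ∀ w, ∃ J₀ : ℤ, ∀ n, J₀ ≤ n → ∀ a, A n a w = 0) {T : Module.End ℂ W}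
    (hT : ∀ w, ∃ J₀ : ℕ, ∀ J, J₀ ≤ J → (2 * κ) • T w =
      casimirMode A c 0 w + (2 : ℂ) • ∑ j ∈ Finset.range J, casimirMode A c (j + 1) w)
    (N : ℕ) (a : 𝔤) :
    T * A (-N) a = A (-N) a * T + (N : ℂ) • A (-N) a := by
  ext w
  obtain ⟨J₁, h₁⟩ := hT w
  obtain ⟨J₂, h₂⟩ := hT (A (-N) a w)
  obtain ⟨J₃, h₃⟩ := hres w
  -- One cutoff serves `T w` and `T (A (-N) a w)`. The extra N makes the upper boundary terms f (J -
  -- i), i < N, vanish, and puts the central term j + 1 = N inside the range.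
  set J : ℕ := J₁ + J₂ + J₃.toNat + N with hJ
  specialize h₁ J (by omega)
  specialize h₂ J (by omega)
  -- All bracket terms of total degree -N are values of this one function, so the commutator with
  -- each Casimir mode is a difference of values of `f`.
  set f : ℤ → W := fun j => adjointMode A c a (-N - j) j w with hf
  have hf0 : ∀ i ∈ Finset.range N, f (J - i) = 0 := by
    intro i hi
    rw [Finset.mem_range] at hi
    simp only [hf, adjointMode, LinearMap.sum_apply, Module.End.mul_apply]
    refine Finset.sum_eq_zero fun p _ => ?_
    rw [h₃ _ (by omega), map_zero]
  have hswap : ∀ i : ℤ, f (-i) + f (-(N - i)) = (2 * h) • A (-N) a w := by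
    intro i
    have := LinearMap.congr_fun (adjointMode_add_swap hA hc hinv hcas a (-N + i) (-i)) w
    rw [LinearMap.add_apply, show -(N : ℤ) + i + -i = -N by ring] at this
    simp only [hf]
    rw [show -(N : ℤ) - -i = -N + i by ring, show -(N : ℤ) - -(N - i) = -i by ring,
      show -((N : ℤ) - i) = -N + i by ring, this, LinearMap.smul_apply]
  have hz : A (-N) a (casimirMode A c 0 w) = casimirMode A c 0 (A (-N) a w) + f 0 - f (-N) := by
    have := LinearMap.congr_fun (mul_casimirMode hA hc hinv a (-N) 0) w
    have h0 : (if (-(N : ℤ)) = 0 then ((-(N : ℤ) : ℤ) : ℂ) * ℓ else 0) = 0 := by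
      split_ifs with h0
      · rw [h0, Int.cast_zero, zero_mul]
      · rfl
    simp only [sub_zero, add_zero, h0, zero_smul] at this
    simpa [hf] using this
  have hp : ∀ j : ℕ, A (-N) a (casimirMode A c (j + 1) w) =
      casimirMode A c (j + 1) (A (-N) a w) + (f (j + 1) - f (j + 1 - N)) -
        (if j + 1 = N then ((N : ℂ) * ℓ) • A (-N) a w else 0) := by
    intro j
    have := LinearMap.congr_fun (mul_casimirMode hA hc hinv a (-N) (j + 1)) w
    rw [if_neg (by omega), zero_smul, add_zero] at this
    simp only [Module.End.mul_apply, LinearMap.add_apply, LinearMap.sub_apply,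
      LinearMap.smul_apply] at this
    rw [this, hf]
    simp only
    rw [show -(N : ℤ) - (j + 1 - N) = -(j + 1) by ring, show -(N : ℤ) + (j + 1) = j + 1 - N by ring]
    by_cases hj : j + 1 = N
    · subst hj
      rw [if_pos (by simp), if_pos rfl]
      push_cast
      rw [neg_mul, neg_smul]
      abel
    · rw [if_neg (by omega), if_neg hj, zero_smul]
      abel
  have hsum : ∑ j ∈ Finset.range J, (if j + 1 = N then ((N : ℂ) * ℓ) • A (-N) a w else 0) =
      ((N : ℂ) * ℓ) • A (-N) a w := by
    rcases N with _ | N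
    · simp
    · simp only [add_left_inj]
      rw [Finset.sum_ite_eq', if_pos (by rw [Finset.mem_range]; omega)]
  have hrefl : ∑ i ∈ Finset.range N, f (-(N - i)) = ∑ i ∈ Finset.range N, f (-(i + 1)) := by
    rw [← Finset.sum_range_reflect]
    refine Finset.sum_congr rfl fun i hi => ?_
    rw [Finset.mem_range] at hi
    congr 1
    omega
  have htel : ∑ i ∈ Finset.range N, f (-(i + 1)) =
      ∑ i ∈ Finset.range N, f (-i) + (f (-N) - f 0) := by
    have := Finset.sum_range_sub (fun i : ℕ => f (-i)) N
    rw [Finset.sum_sub_distrib, sub_eq_iff_eq_add'] at this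
    push_cast at this
    simpa using this
  -- The lower boundary terms of the telescoped sum, together with the contribution of mode 0.
  -- Reflecting i to N - i pairs them by `hswap`, and each of the N pairs gives 2h.
  have hpair : ∑ i ∈ Finset.range N, f (-i) + ∑ i ∈ Finset.range N, f (-i) + (f (-N) - f 0) =
      ((N : ℂ) * (2 * h)) • A (-N) a w := by
    rw [add_assoc, ← htel, ← hrefl, ← Finset.sum_add_distrib,
      Finset.sum_congr rfl fun (i : ℕ) _ => hswap i, Finset.sum_const, Finset.card_range, mul_smul (N : ℂ),
      ← Nat.cast_smul_eq_nsmul ℂ]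
  have hmain : A (-N) a ((2 * κ) • T w) = (2 * κ) • T (A (-N) a w) -
      (2 * κ * N) • A (-N) a w := by
    rw [h₁, h₂, map_add, map_smul, map_sum, hz, Finset.sum_congr rfl fun j _ => hp j,
      Finset.sum_sub_distrib, Finset.sum_add_distrib, hsum, sum_range_sub_shift,
      Finset.sum_sub_distrib, Finset.sum_eq_zero hf0, hℓ,
      show 2 * (ℓ + h) * N = 2 * (N * ℓ) + N * (2 * h) by ring, add_smul _ _ (A (-N) a w), ← hpair,
      mul_smul 2, two_smul, two_smul, two_smul]
    abel
  have h2κ : (2 * κ) ≠ 0 := mul_ne_zero two_ne_zero hκ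
  rw [map_smul, mul_smul (2 * κ), ← smul_sub] at hmain
  rw [Module.End.mul_apply, LinearMap.add_apply, Module.End.mul_apply,
    show A (-N) a (T w) = _ from smul_right_injective W h2κ hmain, LinearMap.smul_apply, sub_add_cancel]

end Sugawara

/-! ### Sums of generalized eigenspaces -/

section GenEigenspaces

variable {W : Type*} [AddCommGroup W] [Module ℂ W]

open Polynomial Module.End

/-- `X` intertwines T - μ with T - (μ + s), hence also their powers. -/
lemma apply_mem_maxGenEigenspace_add {T X : Module.End ℂ W} {s : ℂ} (hX : T * X = X * T + s • X)
    {μ : ℂ} {w : W} (hw : w ∈ T.maxGenEigenspace μ) : X w ∈ T.maxGenEigenspace (μ + s) := by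
  rw [mem_maxGenEigenspace] at hw ⊢
  obtain ⟨k, hk⟩ := hw
  have h1 : SemiconjBy X (T - μ • 1) (T - (μ + s) • 1) := by
    rw [SemiconjBy, mul_sub, sub_mul, hX, mul_smul_comm, smul_mul_assoc, mul_one, one_mul,
      add_smul]
    abel
  refine ⟨k, ?_⟩
  rw [← Module.End.mul_apply, ← (h1.pow_right k).eq, Module.End.mul_apply, hk, map_zero]

lemma apply_mem_iSup_maxGenEigenspace {T X : Module.End ℂ W} {s : ℂ}
    (hX : T * X = X * T + s • X) {w : W} (hw : w ∈ ⨆ μ, T.maxGenEigenspace μ) :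
    X w ∈ ⨆ μ, T.maxGenEigenspace μ := by
  suffices H : (⨆ μ, T.maxGenEigenspace μ) ≤ (⨆ μ, T.maxGenEigenspace μ).comap X from H hw
  exact iSup_le fun μ v hv => Submodule.mem_iSup_of_mem (μ + s) (apply_mem_maxGenEigenspace_add hX hv)

lemma aeval_apply_mem_maxGenEigenspace (T : Module.End ℂ W) (p : ℂ[X]) {μ : ℂ} {w : W}
    (hw : w ∈ T.maxGenEigenspace μ) : aeval T p w ∈ T.maxGenEigenspace μ := by
  have := apply_mem_maxGenEigenspace_add (T := T) (X := aeval T p) (s := 0)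
    (by rw [zero_smul, add_zero]; simpa using ((commute_X p).map (aeval T)).eq) hw
  rwa [add_zero] at this

/-- T - r is invertible on generalized eigenspaces for μ ≠ r. Subtracting a suitable u in the sum
from w therefore brings (T - r)(w - u) into the one for r, and then w - u lies there too. -/
lemma mem_iSup_maxGenEigenspace_of_sub_mem (T : Module.End ℂ W) (r : ℂ) {w : W}
    (hw : (T - r • 1) w ∈ ⨆ μ, T.maxGenEigenspace μ) : w ∈ ⨆ μ, T.maxGenEigenspace μ := by
  have key : ∀ v ∈ ⨆ μ, T.maxGenEigenspace μ, ∃ u ∈ ⨆ μ, T.maxGenEigenspace μ,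
      v - (T - r • 1) u ∈ T.maxGenEigenspace r := by
    intro v hv
    induction hv using Submodule.iSup_induction' with
    | mem μ v hv =>
      by_cases hμ : μ = r
      · exact ⟨0, zero_mem _, by rwa [map_zero, sub_zero, ← hμ]⟩
      obtain ⟨k, hk⟩ := (mem_maxGenEigenspace _ _ _).1 hv
      -- The Bézout coefficient `a` inverts T - r on a vector killed by (T - μ)ᵏ.
      obtain ⟨a, b, hab⟩ : IsCoprime (X - C r) ((X - C μ) ^ k) :=
        (isCoprime_X_sub_C_of_isUnit_sub (sub_ne_zero.2 (Ne.symm hμ)).isUnit).pow_right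
      refine ⟨aeval T a v, Submodule.mem_iSup_of_mem μ (aeval_apply_mem_maxGenEigenspace T a hv), ?_⟩
      have h1 := congrArg (fun p => aeval T p v) hab
      rw [mul_comm a] at h1
      simp only [map_add, map_mul, map_pow, map_sub, aeval_X, aeval_C, map_one,
        LinearMap.add_apply, Module.End.mul_apply, Algebra.algebraMap_eq_smul_one, hk, map_zero,
        add_zero, Module.End.one_apply] at h1
      rw [h1, sub_self]
      exact zero_mem _
    | zero => exact ⟨0, zero_mem _, by rw [map_zero, sub_zero]; exact zero_mem _⟩
    | add v v' _ _ h1 h2 =>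
      obtain ⟨u, hu, hv⟩ := h1
      obtain ⟨u', hu', hv'⟩ := h2
      refine ⟨u + u', add_mem hu hu', ?_⟩
      rw [map_add, add_sub_add_comm]
      exact add_mem hv hv'
  obtain ⟨u, hu, hv⟩ := key _ hw
  rw [← map_sub, mem_maxGenEigenspace] at hv
  obtain ⟨k, hk⟩ := hv
  have h1 : w - u ∈ T.maxGenEigenspace r :=
    (mem_maxGenEigenspace _ _ _).2 ⟨k + 1, by rw [pow_succ, Module.End.mul_apply, hk]⟩
  rw [← sub_add_cancel w u]
  exact add_mem (Submodule.mem_iSup_of_mem r h1) hu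

/-- Over ℂ the polynomial splits, and its linear factors are removed one at a time. -/
lemma mem_iSup_maxGenEigenspace_of_aeval_mem (T : Module.End ℂ W) {p : ℂ[X]} (hp : p ≠ 0) {w : W}
    (hw : aeval T p w ∈ ⨆ μ, T.maxGenEigenspace μ) : w ∈ ⨆ μ, T.maxGenEigenspace μ := by
  have key : ∀ s : Multiset ℂ, aeval T (s.map fun r => X - C r).prod w ∈
      ⨆ μ, T.maxGenEigenspace μ → w ∈ ⨆ μ, T.maxGenEigenspace μ := by
    intro s
    induction s using Multiset.induction_on with
    | empty => simp
    | cons r s ih =>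
      intro hs
      rw [Multiset.map_cons, Multiset.prod_cons, map_mul, Module.End.mul_apply, map_sub, aeval_X,
        aeval_C, Algebra.algebraMap_eq_smul_one] at hs
      exact ih (mem_iSup_maxGenEigenspace_of_sub_mem T r hs)
  refine key p.roots ?_
  rw [(IsAlgClosed.splits p).eq_prod_roots, map_mul, aeval_C, Module.End.mul_apply,
    Module.algebraMap_end_apply] at hw
  exact (Submodule.smul_mem_iff _ (leadingCoeff_ne_zero.2 hp)).1 hw

/-- If an operator agrees modulo the sum of the generalized eigenspaces of `T` with `T` on a
finite-dimensional space which it preserves, then this space lies in that sum. -/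
lemma le_iSup_maxGenEigenspace_of_restrict (T C : Module.End ℂ W) (U : Submodule ℂ W)
    [FiniteDimensional ℂ U] (hC : ∀ w ∈ U, C w ∈ U)
    (hTC : ∀ w ∈ U, T w - C w ∈ ⨆ μ, T.maxGenEigenspace μ) : U ≤ ⨆ μ, T.maxGenEigenspace μ := by
  -- The error stays in the sum of generalized eigenspaces because `T ^ n`, commuting with `T`,
  -- preserves it.
  have hpow : ∀ (n : ℕ) (w : U), (T ^ n) (w : W) - (((C.restrict hC) ^ n) w : U) ∈
      ⨆ μ, T.maxGenEigenspace μ := by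
    intro n
    induction n with
    | zero => intro w; simp
    | succ n ih =>
      intro w
      rw [pow_succ, pow_succ, Module.End.mul_apply, Module.End.mul_apply]
      have h1 := apply_mem_iSup_maxGenEigenspace (T := T) (X := T ^ n) (s := 0)
        (by rw [zero_smul, add_zero, ← pow_succ, ← pow_succ']) (hTC w w.2)
      have h2 := add_mem h1 (ih (C.restrict hC w))
      rwa [map_sub, LinearMap.coe_restrict_apply, sub_add_sub_cancel] at h2
  have hpoly : ∀ (p : ℂ[X]) (w : U), aeval T p (w : W) - (aeval (C.restrict hC) p w : U) ∈
      ⨆ μ, T.maxGenEigenspace μ := by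
    intro p w
    induction p using Polynomial.induction_on' with
    | add p q hp hq =>
      have := add_mem hp hq
      rwa [← add_sub_add_comm, ← LinearMap.add_apply, ← map_add, ← Submodule.coe_add,
        ← LinearMap.add_apply, ← map_add] at this
    | monomial n r =>
      have := Submodule.smul_mem _ r (hpow n w)
      simpa [aeval_monomial, smul_sub] using this
  intro w hw
  -- Cayley–Hamilton: the characteristic polynomial kills the restriction of `C`, so its value at
  -- `T` maps w into the sum.
  refine mem_iSup_maxGenEigenspace_of_aeval_mem T (LinearMap.charpoly_monic (C.restrict hC)).ne_zero ?_
  have := hpoly (C.restrict hC).charpoly ⟨w, hw⟩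
  rwa [LinearMap.aeval_self_charpoly, LinearMap.zero_apply, Submodule.coe_zero, sub_zero] at this

lemma exists_finset_le_biSup {ι : Type*} (p : ι → Submodule ℂ W) (U : Submodule ℂ W)
    [FiniteDimensional ℂ U] (hU : U ≤ ⨆ i, p i) : ∃ s : Finset ι, U ≤ ⨆ i ∈ s, p i :=
  CompleteLattice.IsCompactElement.exists_finset_of_le_iSup _
    ((Submodule.fg_iff_compact U).1 ((Submodule.fg_iff_finiteDimensional U).2 inferInstance)) _ hU

/-- `R` embeds in W/Q, which is a quotient of `P`. -/
lemma finiteDimensional_of_disjoint_of_sup_eq_top {P Q R : Submodule ℂ W} [FiniteDimensional ℂ P]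
    (hPQ : P ⊔ Q = ⊤) (hRQ : Disjoint R Q) : FiniteDimensional ℂ R := by
  have h1 : Function.Surjective (Q.mkQ ∘ₗ P.subtype) := by
    rw [← LinearMap.range_eq_top, LinearMap.range_comp, Submodule.range_subtype,
      Submodule.map_mkQ_eq_top, sup_comm, hPQ]
  have h2 : Function.Injective (Q.mkQ ∘ₗ R.subtype) := by
    rw [← LinearMap.ker_eq_bot, LinearMap.ker_comp, Submodule.ker_mkQ]
    exact Submodule.disjoint_iff_comap_eq_bot.1 hRQ
  have := Module.Finite.of_surjective _ h1
  exact Module.Finite.of_injective _ h2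

end GenEigenspaces

/-! ### Modules generated by a finite-dimensional subspace -/

section Generated

variable {𝔤 : Type*} [LieRing 𝔤] [LieAlgebra ℂ 𝔤] {B : LinearMap.BilinForm ℂ 𝔤}
  {W : Type*} [AddCommGroup W] [Module ℂ W]

/-- The span of the vectors `(a₁ ⊗ t⁻ⁿ¹) ⋯ (a_r ⊗ t⁻ⁿʳ) m` with `m ∈ M`, `nᵢ > 0` and
`n₁ + ⋯ + n_r = d`. -/
def monomialSpan (A : ℤ → 𝔤 →ₗ[ℂ] Module.End ℂ W) (M : Submodule ℂ W) : ℕ → Submodule ℂ W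
  | 0 => M
  | d + 1 => ⨆ i : Fin (d + 1),
      Submodule.map₂ (A (-((d + 1 - i : ℕ) : ℤ))) ⊤ (monomialSpan A M i)

variable {A : ℤ → 𝔤 →ₗ[ℂ] Module.End ℂ W} {M : Submodule ℂ W} {ℓ : ℂ}

lemma finiteDimensional_monomialSpan [FiniteDimensional ℂ 𝔤] [FiniteDimensional ℂ M] (d : ℕ) :
    FiniteDimensional ℂ (monomialSpan A M d) := by
  induction d using Nat.strong_induction_on with
  | _ d ih =>
    rcases d with _ | d
    · rw [monomialSpan]; infer_instance
    · rw [monomialSpan]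
      have : ∀ i : Fin (d + 1), FiniteDimensional ℂ
          (Submodule.map₂ (A (-((d + 1 - i : ℕ) : ℤ))) ⊤ (monomialSpan A M i)) := fun i =>
        Module.Finite.iff_fg.2 (Submodule.FG.map₂ _ Module.Finite.fg_top
          (Module.Finite.iff_fg.1 (ih i i.2)))
      exact Submodule.finiteDimensional_iSup _

lemma apply_mem_monomialSpan (a : 𝔤) {k : ℕ} (hk : 0 < k) {i : ℕ} {w : W}
    (hw : w ∈ monomialSpan A M i) : A (-k) a w ∈ monomialSpan A M (i + k) := by
  obtain ⟨k, rfl⟩ := Nat.exists_eq_succ_of_ne_zero hk.ne'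
  rw [Nat.succ_eq_add_one, ← Nat.add_assoc, monomialSpan]
  refine Submodule.mem_iSup_of_mem ⟨i, by omega⟩ ?_
  rw [show i + k + 1 - i = k + 1 by omega]
  exact Submodule.apply_mem_map₂ _ Submodule.mem_top hw

lemma monomialSpan_le_of_forall {S : ℕ → Submodule ℂ W} (h0 : M ≤ S 0)
    (hS : ∀ (a : 𝔤) (k i : ℕ) (w : W), 0 < k → w ∈ monomialSpan A M i → w ∈ S i →
      A (-k) a w ∈ S (i + k)) (d : ℕ) : monomialSpan A M d ≤ S d := by
  induction d using Nat.strong_induction_on with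
  | _ d ih =>
    rcases d with _ | d
    · rwa [monomialSpan]
    · rw [monomialSpan]
      refine iSup_le fun i => Submodule.map₂_le.2 fun a _ w hw => ?_
      have := hS a (d + 1 - i) i w (by omega) hw (ih i i.2 hw)
      rwa [show (i : ℕ) + (d + 1 - i) = d + 1 by omega] at this

/-- The spanning half of a PBW argument: a mode is commuted past the leading negative mode, leaving
modes applied to a shorter monomial. -/
lemma apply_mem_iSup_monomialSpan (hA : IsAffineAction B ℓ A)
    (hM : ∀ (n : ℤ) (a : 𝔤), 0 ≤ n → ∀ w ∈ M, A n a w ∈ M) (n : ℤ) (a : 𝔤) {w : W}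
    (hw : w ∈ ⨆ d, monomialSpan A M d) : A n a w ∈ ⨆ d, monomialSpan A M d := by
  have hneg : ∀ (k : ℕ) (a : 𝔤) (w : W), 0 < k → w ∈ ⨆ d, monomialSpan A M d →
      A (-k) a w ∈ ⨆ d, monomialSpan A M d := by
    intro k a w hk hw
    suffices H : (⨆ d, monomialSpan A M d) ≤ (⨆ d, monomialSpan A M d).comap (A (-k) a) from H hw
    exact iSup_le fun d w hw => Submodule.mem_iSup_of_mem (d + k) (apply_mem_monomialSpan a hk hw)
  -- All n and a are treated at once, since the commutator with a mode of degree -k produces a mode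
  -- of degree n - k.
  suffices H : ∀ d, monomialSpan A M d ≤
      ⨅ (n : ℤ), ⨅ (a : 𝔤), (⨆ d, monomialSpan A M d).comap (A n a) by
    have := iSup_le H hw
    simp only [Submodule.mem_iInf, Submodule.mem_comap] at this
    exact this n a
  refine monomialSpan_le_of_forall (fun w hw => ?_) fun b k i w hk hwi hw => ?_
  · simp only [Submodule.mem_iInf, Submodule.mem_comap]
    intro n a
    have h0 : M ≤ ⨆ d, monomialSpan A M d := by
      refine le_trans ?_ (le_iSup _ 0)
      rw [monomialSpan]
    rcases le_or_gt 0 n with hn | hn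
    · exact h0 (hM n a hn w hw)
    · have := hneg n.natAbs a w (by omega) (h0 hw)
      rwa [show -(n.natAbs : ℤ) = n by omega] at this
  · simp only [Submodule.mem_iInf, Submodule.mem_comap] at hw ⊢
    intro n a
    rw [← Module.End.mul_apply, hA]
    exact add_mem (add_mem (hneg k b _ hk (hw n a)) (hw _ _))
      (Submodule.smul_mem _ _ (Submodule.mem_iSup_of_mem i hwi))

end Generated

/-! ### Quasi-finite dimensionality -/

section QuasiFinite

variable {𝔤 : Type*} [LieRing 𝔤] [LieAlgebra ℂ 𝔤] {B : LinearMap.BilinForm ℂ 𝔤}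
  {W : Type*} [AddCommGroup W] [Module ℂ W] {ι : Type*} [Fintype ι] {c : Module.Basis ι ℂ 𝔤}
  {A : ℤ → 𝔤 →ₗ[ℂ] Module.End ℂ W} {M : Submodule ℂ W} {ℓ κ : ℂ} {T : Module.End ℂ W}

open Module.End

/-- `hnil` is nilpotency as an induction principle: it suffices to treat vectors of `M` whose
positive modes already lie in V. These form the space `U`. -/
lemma le_iSup_maxGenEigenspace_of_nilpotent [FiniteDimensional ℂ M] (hA : IsAffineAction B ℓ A)
    (hM : ∀ (n : ℤ) (a : 𝔤), 0 ≤ n → ∀ w ∈ M, A n a w ∈ M)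
    (hnil : ∀ U : Submodule ℂ W,
      (∀ w ∈ M, (∀ (n : ℤ) (a : 𝔤), 0 < n → A n a w ∈ U) → w ∈ U) → M ≤ U)
    (hκ : κ ≠ 0)
    (hT : ∀ w, ∃ J₀ : ℕ, ∀ J, J₀ ≤ J → (2 * κ) • T w =
      casimirMode A c 0 w + (2 : ℂ) • ∑ j ∈ Finset.range J, casimirMode A c (j + 1) w)
    (hcomm : ∀ (N : ℕ) (a : 𝔤), T * A (-N) a = A (-N) a * T + (N : ℂ) • A (-N) a) :
    M ≤ ⨆ μ, T.maxGenEigenspace μ := by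
  set V := ⨆ μ, T.maxGenEigenspace μ with hV
  let U : Submodule ℂ W := M ⊓ ⨅ (n : {n : ℤ // 0 < n}), ⨅ (a : 𝔤), V.comap (A n a)
  have hU : ∀ w, w ∈ U ↔ w ∈ M ∧ ∀ (n : ℤ) (a : 𝔤), 0 < n → A n a w ∈ V := by
    intro w
    simp only [U, Submodule.mem_inf, Submodule.mem_iInf, Submodule.mem_comap, Subtype.forall]
    exact and_congr_right fun _ => ⟨fun h n a hn => h n hn a, fun h n hn a => h n a hn⟩
  have hVA : ∀ (N : ℕ) (a : 𝔤) (w : W), w ∈ V → A (-N) a w ∈ V := fun N a w hw =>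
    apply_mem_iSup_maxGenEigenspace (hcomm N a) hw
  have hU0 : ∀ (a : 𝔤), ∀ w ∈ U, A 0 a w ∈ U := by
    intro a w hw
    rw [hU] at hw ⊢
    refine ⟨hM 0 a le_rfl w hw.1, fun n b hn => ?_⟩
    rw [← Module.End.mul_apply, hA, if_neg (by omega), zero_smul, add_zero, add_zero]
    exact add_mem (hVA 0 a _ (hw.2 n b hn)) (hw.2 n _ hn)
  have hUV : U ≤ V := by
    have : FiniteDimensional ℂ U := Submodule.finiteDimensional_inf_left _ _
    -- The remaining terms of `T` are negative modes applied to positive modes of w, so they lie in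
    -- V; only the mode 0 Casimir acts modulo V.
    refine le_iSup_maxGenEigenspace_of_restrict T ((2 * κ)⁻¹ • casimirMode A c 0) U ?_ ?_
    · intro w hw
      rw [LinearMap.smul_apply, casimirMode, LinearMap.sum_apply]
      exact Submodule.smul_mem _ _ (Submodule.sum_mem _ fun p _ => hU0 _ _ (hU0 _ _ hw))
    · intro w hw
      obtain ⟨J, hJ⟩ := hT w
      have h2κ : (2 * κ) ≠ 0 := mul_ne_zero two_ne_zero hκ
      have h1 : T w - ((2 * κ)⁻¹ • casimirMode A c 0) w =
          (2 * κ)⁻¹ • (2 : ℂ) • ∑ j ∈ Finset.range J, casimirMode A c (j + 1) w := by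
        rw [sub_eq_iff_eq_add', LinearMap.smul_apply, ← smul_add, ← hJ J le_rfl,
          inv_smul_smul₀ h2κ]
      rw [h1]
      refine Submodule.smul_mem _ _ (Submodule.smul_mem _ _ (Submodule.sum_mem _ fun j _ => ?_))
      rw [casimirMode, LinearMap.sum_apply]
      exact Submodule.sum_mem _ fun p _ =>
        hVA (j + 1) _ _ (((hU w).1 hw).2 (j + 1) _ (by omega))
  exact hnil V fun w hw h => hUV ((hU w).2 ⟨hw, h⟩)

theorem isInternal_and_isQuasiFiniteDimensional [FiniteDimensional ℂ 𝔤] [FiniteDimensional ℂ M]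
    (hA : IsAffineAction B ℓ A)
    (hM : ∀ (n : ℤ) (a : 𝔤), 0 ≤ n → ∀ w ∈ M, A n a w ∈ M)
    (hgen : ∀ S : Submodule ℂ W, M ≤ S → (∀ (n : ℤ) (a : 𝔤), ∀ w ∈ S, A n a w ∈ S) → S = ⊤)
    (hMT : M ≤ ⨆ μ, T.maxGenEigenspace μ)
    (hcomm : ∀ (N : ℕ) (a : 𝔤), T * A (-N) a = A (-N) a * T + (N : ℂ) • A (-N) a) :
    DirectSum.IsInternal (fun n : ℂ => T.maxGenEigenspace n) ∧ IsQuasiFiniteDimensional T := by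
  have htop : ⨆ d, monomialSpan A M d = ⊤ := by
    refine hgen _ (le_trans ?_ (le_iSup _ 0)) fun n a w hw => apply_mem_iSup_monomialSpan hA hM n a hw
    rw [monomialSpan]
  obtain ⟨Λ, hΛ⟩ := exists_finset_le_biSup _ M hMT
  have hle : ∀ d, monomialSpan A M d ≤ ⨆ μ ∈ Λ, T.maxGenEigenspace (μ + d) := by
    refine monomialSpan_le_of_forall (by simpa using hΛ) fun a k i w _ _ hw => ?_
    suffices H : (⨆ μ ∈ Λ, T.maxGenEigenspace (μ + i)) ≤
        (⨆ μ ∈ Λ, T.maxGenEigenspace (μ + (i + k : ℕ))).comap (A (-k) a) from H hw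
    refine iSup₂_le fun μ hμ v hv => ?_
    refine Submodule.mem_iSup_of_mem μ (Submodule.mem_iSup_of_mem hμ ?_)
    rw [Nat.cast_add, ← add_assoc]
    exact apply_mem_maxGenEigenspace_add (hcomm k a) hv
  refine ⟨(DirectSum.isInternal_submodule_iff_iSupIndep_and_iSup_eq_top _).2
    ⟨independent_maxGenEigenspace T, ?_⟩, fun N => ?_⟩
  · rw [eq_top_iff, ← htop]
    exact iSup_le fun d => (hle d).trans (iSup₂_le fun μ _ => le_iSup T.maxGenEigenspace (μ + d))
  -- Every μ in Λ has real part at least -r, so in degrees d ≥ D ≥ N + r all eigenvalues have real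
  -- part at least N. The degrees below D then span W modulo the eigenspaces in `Q`.
  · obtain ⟨r, hr⟩ := (Λ.image fun μ => -μ.re).exists_le
    obtain ⟨D, hD⟩ := exists_nat_ge (N + r)
    have hfin : ∀ d : Fin D, FiniteDimensional ℂ (monomialSpan A M d) := fun d =>
      finiteDimensional_monomialSpan d
    have hfin' := Submodule.finiteDimensional_iSup fun d : Fin D => monomialSpan A M d
    refine finiteDimensional_of_disjoint_of_sup_eq_top
      (P := ⨆ d : Fin D, monomialSpan A M d)
      (Q := ⨆ n ∈ {n : ℂ | n.re < N}ᶜ, T.maxGenEigenspace n) ?_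
      ((independent_maxGenEigenspace T).disjoint_biSup_biSup disjoint_compl_right)
    rw [eq_top_iff, ← htop]
    refine iSup_le fun d => ?_
    rcases lt_or_ge d D with hd | hd
    · exact (le_iSup (fun d : Fin D => monomialSpan A M d) ⟨d, hd⟩).trans le_sup_left
    · refine ((hle d).trans (iSup₂_le fun μ hμ => ?_)).trans le_sup_right
      refine le_iSup₂_of_le (μ + d) ?_ le_rfl
      have h1 := hr _ (Finset.mem_image_of_mem _ hμ)
      have h2 : (D : ℝ) ≤ d := by exact_mod_cast hd
      simp only [Set.mem_compl_iff, Set.mem_ofPred_eq, not_lt, Complex.add_re, Complex.natCast_re]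
      linarith

end QuasiFinite

/-! ### Objects of `𝒪_κ` -/

section CategoryO

open AffineLieAlgebra

variable {𝔤 : Type*} [LieRing 𝔤] [LieAlgebra ℂ 𝔤]
  {B : LinearMap.BilinForm ℂ 𝔤} {hinv : B.lieInvariant 𝔤} {hsymm : B.IsSymm}
  {W : Type*} [AddCommGroup W] [Module ℂ W]
  [LieRingModule (AffineLieAlgebra B hinv hsymm) W] [LieModule ℂ (AffineLieAlgebra B hinv hsymm) W]

variable (B hinv hsymm W) in
/-- The action of `a ⊗ tⁿ` on `W`. -/
def modeEnd (n : ℤ) : 𝔤 →ₗ[ℂ] Module.End ℂ W :=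
  (LieModule.toEnd ℂ (AffineLieAlgebra B hinv hsymm) W : _ →ₗ[ℂ] _) ∘ₗ tpow B hinv hsymm n

lemma modeEnd_apply (n : ℤ) (a : 𝔤) (w : W) :
    modeEnd B hinv hsymm W n a w = ⁅tpow B hinv hsymm n a, w⁆ := rfl

lemma isAffineAction_modeEnd {ℓ : ℂ} (hℓ : ∀ w : W, ⁅central B hinv hsymm, w⁆ = ℓ • w) :
    IsAffineAction B ℓ (modeEnd B hinv hsymm W) := by
  intro m n a b
  ext w
  simp only [Module.End.mul_apply, LinearMap.add_apply, LinearMap.smul_apply, modeEnd_apply,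
    Module.End.one_apply]
  rw [leibniz_lie, tpow_lie_tpow, add_lie, smul_lie, hℓ, smul_smul, ite_mul, zero_mul, add_comm,
    ← add_assoc]

lemma IsRestricted.exists_forall_le [FiniteDimensional ℂ 𝔤] (hW : IsRestricted B hinv hsymm W)
    (w : W) : ∃ J₀ : ℤ, ∀ n, J₀ ≤ n → ∀ a, modeEnd B hinv hsymm W n a w = 0 := by
  let b := Module.finBasis ℂ 𝔤
  choose N hN using fun p => hW (b p) w
  obtain ⟨N', hN'⟩ := (Set.finite_range N).bddAbove
  refine ⟨N', fun n hn a => ?_⟩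
  have : (modeEnd B hinv hsymm W n).flip w = 0 :=
    b.ext fun p => hN p n ((hN' ⟨p, rfl⟩).trans hn)
  exact LinearMap.congr_fun this a

/-- Normal ordering puts the nonnegative mode on the right, so the summands j and -j coincide. -/
lemma segalSugawaraTerm_zero {ι : Type*} [Fintype ι] (c : Module.Basis ι ℂ 𝔤) (j : ℤ) (w : W) :
    segalSugawaraTerm B hinv hsymm c 0 j w = casimirMode (modeEnd B hinv hsymm W) c |j| w := by
  simp only [segalSugawaraTerm, casimirMode, LinearMap.sum_apply, Module.End.mul_apply,
    modeEnd_apply, add_zero, neg_zero]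
  split_ifs with h
  · rw [abs_of_nonneg (by omega)]
  · rw [abs_of_neg (by omega), neg_neg]

lemma finsum_abs_eq {V : Type*} [AddCommGroup V] [Module ℂ V] (f : ℤ → V) (J : ℕ)
    (hf : ∀ j : ℤ, (J : ℤ) < j → f j = 0) :
    ∑ᶠ j : ℤ, f |j| = f 0 + (2 : ℂ) • ∑ j ∈ Finset.range J, f (j + 1) := by
  have h1 : (Function.support fun j : ℤ => f |j|) ⊆ (Finset.Icc (-(J : ℤ)) J : Finset ℤ) := by
    intro j hj
    rw [Finset.coe_Icc, Set.mem_Icc, ← abs_le]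
    exact not_lt.1 fun h => hj (hf _ h)
  rw [finsum_eq_sum_of_support_subset _ h1]
  clear h1 hf
  induction J with
  | zero => simp
  | succ J ih =>
    have h2 : Finset.Icc (-((J + 1 : ℕ) : ℤ)) (J + 1 : ℕ) =
        insert (-((J + 1 : ℕ) : ℤ)) (insert ((J + 1 : ℕ) : ℤ) (Finset.Icc (-(J : ℤ)) J)) := by
      ext j
      simp only [Finset.mem_insert, Finset.mem_Icc]
      omega
    have h3 : |((J : ℤ) + 1)| = J + 1 := abs_of_nonneg (by omega)
    rw [h2, Finset.sum_insert (by simp; omega), Finset.sum_insert (by simp), ih,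
      Finset.sum_range_succ, smul_add, two_smul ℂ (f (J + 1)), abs_neg]
    push_cast
    rw [h3]
    abel

/-- The identity is given for every large cutoff, so that two vectors can share one. -/
lemma smul_segalSugawara_zero [FiniteDimensional ℂ 𝔤] (hW : IsRestricted B hinv hsymm W) {κ : ℂ}
    (hκ : κ ≠ 0) {ι : Type*} [Fintype ι] (c : Module.Basis ι ℂ 𝔤) (w : W) :
    ∃ J₀ : ℕ, ∀ J, J₀ ≤ J → (2 * κ) • segalSugawara hW κ c 0 w =
      casimirMode (modeEnd B hinv hsymm W) c 0 w + (2 : ℂ) • ∑ j ∈ Finset.range J,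
        casimirMode (modeEnd B hinv hsymm W) c (j + 1) w := by
  obtain ⟨J₀, hJ₀⟩ := hW.exists_forall_le w
  refine ⟨J₀.toNat, fun J hJ => ?_⟩
  have h2κ : (2 * κ) ≠ 0 := mul_ne_zero two_ne_zero hκ
  change (2 * κ) • (1 / (2 * κ)) • ∑ᶠ j : ℤ, segalSugawaraTerm B hinv hsymm c 0 j w = _
  rw [one_div, smul_inv_smul₀ h2κ]
  simp only [segalSugawaraTerm_zero]
  refine finsum_abs_eq (fun j => casimirMode (modeEnd B hinv hsymm W) c j w) J fun j hj => ?_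
  rw [casimirMode, LinearMap.sum_apply]
  refine Finset.sum_eq_zero fun p _ => ?_
  rw [Module.End.mul_apply, hJ₀ j (by omega), map_zero]

/-! ### Quotients of induced modules -/

section Quotient

set_option linter.unusedSectionVars false

variable {M : Type*} [AddCommGroup M] [Module ℂ M] [LieRingModule (nonpos B hinv hsymm) M]
  [LieModule ℂ (nonpos B hinv hsymm) M]
  (π : InducedModule (nonpos B hinv hsymm) M →ₗ⁅ℂ, AffineLieAlgebra B hinv hsymm⁆ W)

/-- The map `m ↦ π (1 ⊗ m)`. -/
def topMap : M →ₗ[ℂ] W where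
  toFun m := π (InducedModule.of (R := ℂ) (nonpos B hinv hsymm) M m)
  map_add' m m' := by
    rw [← map_add, InducedModule.of, InducedModule.of, InducedModule.of, TensorProduct.tmul_add,
      map_add]
  map_smul' r m := by
    rw [InducedModule.of, TensorProduct.tmul_smul, LinearMap.map_smul_of_tower, map_smul]
    rfl

lemma lie_topMap (x : nonpos B hinv hsymm) (m : M) :
    ⁅(x : AffineLieAlgebra B hinv hsymm), topMap π m⁆ = topMap π ⁅x, m⁆ := by
  refine (LieModuleHom.map_lie π _ _).symm.trans ?_
  exact congrArg π (InducedModule.lie_of (R := ℂ) _ M x m)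

/-- A quotient of an induced module is generated by the image of `M`. -/
lemma eq_top_of_range_topMap_le (hπ : Function.Surjective π) (S : Submodule ℂ W)
    (h0 : LinearMap.range (topMap π) ≤ S)
    (hS : ∀ x : AffineLieAlgebra B hinv hsymm, ∀ w ∈ S, ⁅x, w⁆ ∈ S) : S = ⊤ := by
  suffices H : ∀ (u : UniversalEnvelopingAlgebra ℂ (AffineLieAlgebra B hinv hsymm))
      (v : InducedModule (nonpos B hinv hsymm) M), π v ∈ S → π (u • v) ∈ S by
    rw [eq_top_iff]
    rintro w -
    obtain ⟨v, rfl⟩ := hπ w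
    obtain ⟨z, rfl⟩ := Submodule.mkQ_surjective _ v
    induction z using TensorProduct.induction_on with
    | zero => rw [map_zero, map_zero]; exact zero_mem _
    | add x y hx hy => rw [map_add, map_add]; exact add_mem hx hy
    | tmul u m =>
      have hu : u ⊗ₜ[ℂ] m = u • ((1 : UniversalEnvelopingAlgebra ℂ
          (AffineLieAlgebra B hinv hsymm)) ⊗ₜ[ℂ] m) := by
        rw [TensorProduct.smul_tmul', smul_eq_mul, mul_one]
      rw [hu, map_smul]
      exact H u _ (h0 ⟨m, rfl⟩)
  intro u
  have hu : u ∈ Algebra.adjoin ℂ (Set.range (UniversalEnvelopingAlgebra.ι ℂ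
      (L := AffineLieAlgebra B hinv hsymm))) :=
    InducedModule.adjoin_range_ι (R := ℂ) (L := AffineLieAlgebra B hinv hsymm) ▸ Algebra.mem_top
  induction hu using Algebra.adjoin_induction with
  | mem u hu =>
    obtain ⟨x, rfl⟩ := hu
    intro v hv
    rw [← InducedModule.lie_def, LieModuleHom.map_lie]
    exact hS x _ hv
  | algebraMap r =>
    intro v hv
    rw [algebraMap_smul, map_smul]
    exact Submodule.smul_mem _ _ hv
  | add u u' _ _ h1 h2 =>
    intro v hv
    rw [add_smul, map_add]
    exact add_mem (h1 v hv) (h2 v hv)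
  | mul u u' _ _ h1 h2 =>
    intro v hv
    rw [mul_smul]
    exact h1 _ (h2 v hv)

/-- The vectors on which 𝐤 acts as ℓ form a submodule, 𝐤 being central, and it contains the
generating image of M. -/
lemma central_lie_of_level (hπ : Function.Surjective π) {ℓ : ℂ}
    (hℓ : ∀ m : M, ⁅(⟨central B hinv hsymm, central_mem_nonpos B hinv hsymm⟩ :
      nonpos B hinv hsymm), m⁆ = ℓ • m) (w : W) : ⁅central B hinv hsymm, w⁆ = ℓ • w := by
  let S : Submodule ℂ W :=
    LinearMap.eqLocus (LieModule.toEnd ℂ _ W (central B hinv hsymm)) (ℓ • 1)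
  have hS : ∀ w, w ∈ S ↔ ⁅central B hinv hsymm, w⁆ = ℓ • w := fun w => Iff.rfl
  rw [← hS, eq_top_of_range_topMap_le π hπ S]
  · trivial
  · rintro _ ⟨m, rfl⟩
    rw [hS, ← map_smul, ← hℓ]
    exact lie_topMap π ⟨central B hinv hsymm, central_mem_nonpos B hinv hsymm⟩ m
  · intro x w hw
    rw [hS] at hw ⊢
    rw [leibniz_lie, central_lie, zero_lie, zero_add, hw, lie_smul]

lemma eq_top_of_forall_modeEnd (hπ : Function.Surjective π) {ℓ : ℂ}
    (hℓ : ∀ w : W, ⁅central B hinv hsymm, w⁆ = ℓ • w) (S : Submodule ℂ W)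
    (h0 : LinearMap.range (topMap π) ≤ S)
    (hS : ∀ (n : ℤ) (a : 𝔤), ∀ w ∈ S, modeEnd B hinv hsymm W n a w ∈ S) : S = ⊤ := by
  refine eq_top_of_range_topMap_le π hπ S h0 fun x w hw => ?_
  have hx := span_eq_top B hinv hsymm ▸ Submodule.mem_top (R := ℂ) (x := x)
  induction hx using Submodule.span_induction with
  | mem x hx =>
    rcases hx with ⟨m, b, rfl⟩ | rfl
    · exact hS m b w hw
    · rw [hℓ]; exact S.smul_mem _ hw
  | zero => rw [zero_lie]; exact zero_mem _
  | add x y _ _ h1 h2 => rw [add_lie]; exact add_mem h1 h2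
  | smul r x _ h => rw [smul_lie]; exact Submodule.smul_mem _ _ h

lemma range_topMap_le_of_isNilpotent
    (hnil : LieModule.IsNilpotent ((minus B hinv hsymm).comap (nonpos B hinv hsymm).incl) M)
    (U : Submodule ℂ W)
    (hU : ∀ w ∈ LinearMap.range (topMap π),
      (∀ (n : ℤ) (a : 𝔤), 0 < n → modeEnd B hinv hsymm W n a w ∈ U) → w ∈ U) :
    LinearMap.range (topMap π) ≤ U := by
  set K := (minus B hinv hsymm).comap (nonpos B hinv hsymm).incl
  obtain ⟨k, hk⟩ := (LieModule.isNilpotent_iff ℂ K M).1 hnil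
  -- Induction up the lower central series from its zero term: a positive mode sends each term into
  -- the next.
  have key : ∀ i, i ≤ k → ∀ m ∈ LieModule.lowerCentralSeries ℂ K M (k - i), topMap π m ∈ U := by
    intro i
    induction i with
    | zero =>
      intro _ m hm
      rw [Nat.sub_zero, hk, LieSubmodule.mem_bot] at hm
      rw [hm, map_zero]
      exact zero_mem _
    | succ i ih =>
      intro hi m hm
      refine hU _ ⟨m, rfl⟩ fun n a hn => ?_
      let x : nonpos B hinv hsymm := ⟨tpow B hinv hsymm n a, tpow_mem_nonpos B hinv hsymm hn.le a⟩
      have hx : x ∈ K := Submodule.subset_span ⟨n, a, hn, rfl⟩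
      rw [modeEnd_apply, show tpow B hinv hsymm n a = (x : AffineLieAlgebra B hinv hsymm) from rfl,
        lie_topMap]
      refine ih (by omega) _ ?_
      rw [show k - i = k - (i + 1) + 1 by omega, LieModule.lowerCentralSeries_succ]
      exact LieSubmodule.lie_mem_lie (x := (⟨x, hx⟩ : K)) (LieSubmodule.mem_top _) hm
  rintro _ ⟨m, rfl⟩
  refine key k le_rfl m ?_
  rw [Nat.sub_self, LieModule.lowerCentralSeries_zero]
  exact LieSubmodule.mem_top _

end Quotient

end CategoryO

end

theorem mainTheorem7 {𝔤 : Type*} [LieRing 𝔤] [LieAlgebra ℂ 𝔤] [FiniteDimensional ℂ 𝔤]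
    [LieAlgebra.IsSemisimple ℂ 𝔤]
    (B : LinearMap.BilinForm ℂ 𝔤) (hinv : B.lieInvariant 𝔤) (hsymm : B.IsSymm)
    (hnondeg : B.Nondegenerate)
    (h κ : ℂ) (hh : IsDualCoxeterNumber B h) (hκ : ∀ q : ℚ, 0 ≤ q → κ ≠ (q : ℂ))
    {ι : Type*} [Fintype ι] [DecidableEq ι] (c : Module.Basis ι ℂ 𝔤)
    (hc : ∀ p q : ι, B (c p) (c q) = if p = q then 1 else 0)
    (W : Type*) [AddCommGroup W] [Module ℂ W]
    [LieRingModule (AffineLieAlgebra B hinv hsymm) W]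
    [LieModule ℂ (AffineLieAlgebra B hinv hsymm) W]
    (hW : IsObjectO B hinv hsymm W h κ) :
    DirectSum.IsInternal
      (fun n : ℂ => (segalSugawara hW.isRestricted κ c 0).maxGenEigenspace n) ∧
    IsQuasiFiniteDimensional (segalSugawara hW.isRestricted κ c 0) := by

  have hκ0 : κ ≠ 0 := fun h0 => hκ 0 le_rfl (by rw [h0, Rat.cast_zero])
  have hres := hW.isRestricted
  obtain ⟨M, _, _, _, _, hM, π, hπ⟩ := id hW
  have := hM.finiteDimensional
  have hℓ := central_lie_of_level π hπ hM.level
  have hA := isAffineAction_modeEnd hℓ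
  have hT := smul_segalSugawara_zero hres hκ0 c
  have hcomm := sugawara_commutation hA hc hinv
    (sum_lie_lie_of_isDualCoxeterNumber hc hinv hnondeg hh) (sub_add_cancel κ h).symm hκ0
    hres.exists_forall_le hT
  have hpos : ∀ (n : ℤ) (a : 𝔤), 0 ≤ n → ∀ w ∈ LinearMap.range (topMap π),
      modeEnd B hinv hsymm W n a w ∈ LinearMap.range (topMap π) := by
    rintro n a hn _ ⟨m, rfl⟩
    exact ⟨_, (lie_topMap π ⟨AffineLieAlgebra.tpow B hinv hsymm n a,
      AffineLieAlgebra.tpow_mem_nonpos B hinv hsymm hn a⟩ m).symm⟩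
  exact isInternal_and_isQuasiFiniteDimensional hA hpos (eq_top_of_forall_modeEnd π hπ hℓ)
    (le_iSup_maxGenEigenspace_of_nilpotent hA hpos
      (range_topMap_le_of_isNilpotent π hM.nilpotent) hκ0 hT hcomm) hcomm
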